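/- For every $K\ge 1$ let $M=M(K)>K$ be an integer, where $M$ and $K$ grow at the same pace, that is, the ratio $K/M$ stays bounded away from $0$ as $K\to\infty$. Let ${\bf H}={\bf H}_K\in\mathbb C^{M\times K}$ and ${\bf u}={\bf u}_K\in\mathbb C^K$ be random, defined for all $K$ on one probability space, such that for each $K$ all the entries of ${\bf H}_K$ and ${\bf u}_K$ are jointly independent and $\mathcal{CN}(0,1)$ distributed (the uncorrelated channel ${\bf R}={\bf I}_M$). For fixed $\gamma>0$ and $\rho>0$ let $$P(\rho)=\gamma\,{\bf u}^{\sf H}({\bf H}^{\sf H}{\bf H}+\delta{\bf I}_K)^{-1}{\bf H}^{\sf H}{\bf H}({\bf H}^{\sf H}{\bf H}+\delta{\bf I}_K)^{-1}{\bf u},\qquad \delta=K\rho,$$ which is the power ${\bf x}^{\sf H}{\bf x}$ of the precoded vector ${\bf x}=({\bf A}+\delta{\bf I}_M)^{-1}{\bf A}{\bf b}$, with ${\bf A}={\bf H}{\bf H}^{\sf H}$ and ${\bf b}=\sqrt\gamma\,{\bf H}({\bf H}^{\sf H}{\bf H})^{-1}{\bf u}$. Then $$P(\rho)-\gamma\left[m(\rho)+\rho\,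 m'(\rho)\right]\longrightarrow 0\quad\text{almost surely as }K\to\infty,$$ where $$m(\rho)=\frac{-2}{1-c-\rho-\sqrt{(1-c+\rho)^2+4c\rho}},\qquad c=\frac MK ,$$ and $m'$ is the derivative of $m$ with respect to $\rho$ ($m$ depends on $K$ through $c$). -/

import Mathlib

open MeasureTheory ProbabilityTheory Filter Topology Asymptotics Matrix
open scoped ComplexOrder

noncomputable section

/-- The circularly symmetric standard complex Gaussian law `CN(0, 1)` on `ℂ`: the real and the
imaginary parts are independent real centred Gaussians of variance `1 / 2`. -/
def stdComplexGaussian : Measure ℂ :=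
  ((gaussianReal 0 (1 / 2)).prod (gaussianReal 0 (1 / 2))).map
    (fun p : ℝ × ℝ => (⟨p.1, p.2⟩ : ℂ))

/-- The zero-forcing vector `b = √γ H (Hᴴ H)⁻¹ u`. -/
def zfVector {m k : Type*} [Fintype m] [DecidableEq m] [Fintype k] [DecidableEq k]
    (γ : ℝ) (H : Matrix m k ℂ) (u : k → ℂ) : m → ℂ :=
  ((Real.sqrt γ : ℝ) : ℂ) • (H *ᵥ ((Hᴴ * H)⁻¹ *ᵥ u))

/-- The precoded vector `x = (A + δ I)⁻¹ A b`, with `A = H Hᴴ` and `b` the zero-forcing vector. -/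
def precodedVector {m k : Type*} [Fintype m] [DecidableEq m] [Fintype k] [DecidableEq k]
    (γ δ : ℝ) (H : Matrix m k ℂ) (u : k → ℂ) : m → ℂ :=
  (H * Hᴴ + (δ : ℂ) • (1 : Matrix m m ℂ))⁻¹ *ᵥ ((H * Hᴴ) *ᵥ zfVector γ H u)

/-- The transmit power `P(δ) = γ uᴴ (Hᴴ H + δ I)⁻¹ Hᴴ H (Hᴴ H + δ I)⁻¹ u` for the Lagrange
multiplier `δ`. The quadratic form is real, so that taking the real part changes nothing. -/
def transmitPower {m k : Type*} [Fintype m] [Fintype k] [DecidableEq k]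
    (γ δ : ℝ) (H : Matrix m k ℂ) (u : k → ℂ) : ℝ :=
  γ * (star u ⬝ᵥ (((Hᴴ * H + (δ : ℂ) • (1 : Matrix k k ℂ))⁻¹ * (Hᴴ * H) *
    (Hᴴ * H + (δ : ℂ) • (1 : Matrix k k ℂ))⁻¹) *ᵥ u)).re

/-- The function `m(ρ) = -2 / (1 - c - ρ - √((1 - c + ρ)² + 4 c ρ))` with aspect ratio `c`. -/
def mpTransform (c ρ : ℝ) : ℝ :=
  -2 / (1 - c - ρ - Real.sqrt ((1 - c + ρ) ^ 2 + 4 * c * ρ))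

/-- For `δ > 0` the matrices `Hᴴ H + δ I` are invertible. -/
theorem isUnit_regularized {m k : Type*} [Fintype m] [Fintype k] [DecidableEq k]
    {δ : ℝ} (hδ : 0 < δ) (H : Matrix m k ℂ) :
    IsUnit (Hᴴ * H + (δ : ℂ) • (1 : Matrix k k ℂ)) := by
  have h1 : (Hᴴ * H).PosSemidef := posSemidef_conjTranspose_mul_self H
  have h2 : ((δ : ℂ) • (1 : Matrix k k ℂ)).PosDef :=
    PosDef.one.smul (by exact_mod_cast hδ)
  exact (PosDef.posSemidef_add h1 h2).isUnit

/-- `P(δ) = xᴴ x` for the precoded vector `x`, whenever the zero-forcing vector makes sense. -/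
theorem transmitPower_eq {m k : Type*} [Fintype m] [DecidableEq m] [Fintype k] [DecidableEq k]
    {γ δ : ℝ} (hγ : 0 ≤ γ) (hδ : 0 < δ) (H : Matrix m k ℂ) (u : k → ℂ) (hH : IsUnit (Hᴴ * H)) :
    star (precodedVector γ δ H u) ⬝ᵥ precodedVector γ δ H u = (transmitPower γ δ H u : ℂ) := by
  set G := Hᴴ * H with hG
  set B := G + (δ : ℂ) • (1 : Matrix k k ℂ) with hB
  set C := H * Hᴴ + (δ : ℂ) • (1 : Matrix m m ℂ) with hC
  have hGH : Gᴴ = G := by simp [hG]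
  have hBH : Bᴴ = B := by simp [hB, hGH]
  have hBu : IsUnit B.det := (isUnit_iff_isUnit_det _).1 (isUnit_regularized hδ H)
  have hCu : IsUnit C.det := by
    have := isUnit_regularized hδ Hᴴ
    rw [conjTranspose_conjTranspose] at this
    exact (isUnit_iff_isUnit_det _).1 this
  have hGu : IsUnit G.det := (isUnit_iff_isUnit_det _).1 hH
  have hCB : C * H = H * B := by
    simp [hC, hB, hG, Matrix.add_mul, Matrix.mul_add, Matrix.mul_assoc]
  have hpush : C⁻¹ * H = H * B⁻¹ := by
    calc C⁻¹ * H = C⁻¹ * (H * B) * B⁻¹ := by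
          rw [Matrix.mul_assoc, Matrix.mul_assoc, mul_nonsing_inv _ hBu, Matrix.mul_one]
      _ = H * B⁻¹ := by
          rw [← hCB, ← Matrix.mul_assoc, nonsing_inv_mul _ hCu, Matrix.one_mul]
  have hx : precodedVector γ δ H u = ((Real.sqrt γ : ℝ) : ℂ) • ((H * B⁻¹) *ᵥ u) := by
    unfold precodedVector zfVector
    rw [← hC, ← hG, mulVec_smul, mulVec_smul, mulVec_mulVec, mulVec_mulVec, mulVec_mulVec,
      ← hpush]
    congr 2
    calc C⁻¹ * (H * Hᴴ) * H * G⁻¹ = C⁻¹ * H * (G * G⁻¹) := by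
          rw [hG]; simp only [Matrix.mul_assoc]
      _ = C⁻¹ * H := by rw [mul_nonsing_inv _ hGu, Matrix.mul_one]
  have hS : B⁻¹ * G * B⁻¹ = (H * B⁻¹)ᴴ * (H * B⁻¹) := by
    rw [conjTranspose_mul, conjTranspose_nonsing_inv, hBH, hG]
    simp only [Matrix.mul_assoc]
  have hq : star u ⬝ᵥ ((B⁻¹ * G * B⁻¹) *ᵥ u)
      = star ((H * B⁻¹) *ᵥ u) ⬝ᵥ ((H * B⁻¹) *ᵥ u) := by
    rw [hS, star_mulVec, ← mulVec_mulVec, dotProduct_mulVec]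
  have hre : ((star ((H * B⁻¹) *ᵥ u) ⬝ᵥ ((H * B⁻¹) *ᵥ u)).re : ℂ)
      = star ((H * B⁻¹) *ᵥ u) ⬝ᵥ ((H * B⁻¹) *ᵥ u) := by
    have := (Complex.nonneg_iff.1 (dotProduct_star_self_nonneg ((H * B⁻¹) *ᵥ u))).2
    exact Complex.ext (by simp) (by rw [Complex.ofReal_im]; exact this)
  have hs : ((Real.sqrt γ : ℝ) : ℂ) * ((Real.sqrt γ : ℝ) : ℂ) = (γ : ℂ) := by
    rw [← Complex.ofReal_mul, Real.mul_self_sqrt hγ]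
  unfold transmitPower
  rw [← hG, ← hB, hq, Complex.ofReal_mul, hre, hx, star_smul, smul_dotProduct, dotProduct_smul,
    smul_eq_mul, smul_eq_mul, ← mul_assoc, ← hs]
  simp

/-- The function `m` is differentiable on `(0, ∞)`, so that `deriv` is its true derivative. -/
theorem differentiableAt_mpTransform {c ρ : ℝ} (hρ : 0 < ρ) :
    DifferentiableAt ℝ (mpTransform c) ρ := by
  have e : (1 - c + ρ) ^ 2 + 4 * c * ρ = (1 - c - ρ) ^ 2 + 4 * ρ := by ring
  have h1 : 0 < (1 - c + ρ) ^ 2 + 4 * c * ρ := by rw [e]; positivity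
  have h2 : 1 - c - ρ < Real.sqrt ((1 - c + ρ) ^ 2 + 4 * c * ρ) :=
    Real.lt_sqrt_of_sq_lt (by rw [e]; linarith)
  unfold mpTransform
  refine (differentiableAt_const _).div ?_ (by linarith)
  refine DifferentiableAt.sub (by fun_prop) (DifferentiableAt.sqrt (by fun_prop) h1.ne')

end

/-! Write g(δ) = uᴴ(HᴴH + δ)⁻¹u. Unitary invariance lets u be replaced by ‖u‖e₁, and the Schur
complement then gives g = ‖u‖² / (δ(1 + g̃)). Here g̃ is the same form for the adjoint of the
remaining columns and the first column, and it is independent of ‖u‖ (`resolventLaw_succ`). Two such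
steps lower both dimensions by one.

With δ = Kρ fixed and the squared norms concentrated near K and M, a double step is close to z ↦ (1
+ z)/(ρ(1 + z) + c). Since c ≥ 1, this map contracts towards its fixed point m(ρ) by a factor 1/(1 +
ρ) (`abs_inv_sub_le_of_fixedPoint`). A number of double steps independent of K, started from the
crude bound g ≤ ‖u‖²/δ, gives exponentially small failure probabilities, and Borel–Cantelli gives g
− m → 0 almost surely.

Finally P = γ(g + δg′). Both g′ and m′ are replaced by difference quotients with step proportional
to h; the errors are O(h) uniformly in large K (`abs_transmitPower_sub_le`,
`abs_deriv_mpTransform_add_le`), so h → 0 may be taken after K → ∞. -/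

/-! ### Gaussian vectors and their invariance. -/

instance : IsProbabilityMeasure stdComplexGaussian :=
  Measure.isProbabilityMeasure_map
    (Complex.measurableEquivRealProd.symm.measurable.aemeasurable)

theorem integral_stdComplexGaussian {E : Type*} [NormedAddCommGroup E] [NormedSpace ℝ E]
    (f : ℂ → E) :
    ∫ z, f z ∂stdComplexGaussian =
      ∫ p : ℝ × ℝ, f ⟨p.1, p.2⟩ ∂((gaussianReal 0 (1 / 2)).prod (gaussianReal 0 (1 / 2))) :=
  integral_map_equiv Complex.measurableEquivRealProd.symm f

theorem charFun_stdComplexGaussian (t : ℂ) :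
    charFun stdComplexGaussian t = Complex.exp (((-(‖t‖ ^ 2 / 4) : ℝ)) : ℂ) := by
  rw [charFun_apply, integral_stdComplexGaussian]
  have h1 : ∀ p : ℝ × ℝ, Complex.exp (((inner ℝ (⟨p.1, p.2⟩ : ℂ) t : ℝ) : ℂ) * Complex.I) =
      Complex.exp (t.re * p.1 * Complex.I) * Complex.exp (t.im * p.2 * Complex.I) := by
    intro p
    rw [← Complex.exp_add, Complex.inner]
    congr 1
    simp
    ring
  simp_rw [h1]
  rw [integral_prod_mul (fun x : ℝ => Complex.exp (t.re * x * Complex.I))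
    (fun x : ℝ => Complex.exp (t.im * x * Complex.I)), ← charFun_apply_real, ← charFun_apply_real,
    charFun_gaussianReal, charFun_gaussianReal, ← Complex.exp_add]
  congr 1
  rw [Complex.sq_norm, Complex.normSq_apply]
  push_cast
  simp
  ring

/-- The law of a vector of independent `CN(0, 1)` entries. -/
noncomputable def gaussianVector (ι : Type*) [Fintype ι] : Measure (ι → ℂ) :=
  Measure.pi fun _ => stdComplexGaussian

instance (ι : Type*) [Fintype ι] : IsProbabilityMeasure (gaussianVector ι) := by
  unfold gaussianVector; infer_instance

theorem charFun_gaussianVector {ι : Type*} [Fintype ι] (t : ι → ℂ) :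
    charFun ((gaussianVector ι).map (WithLp.toLp 2)) (WithLp.toLp 2 t) =
      Complex.exp (((-((∑ i, ‖t i‖ ^ 2) / 4) : ℝ)) : ℂ) := by
  rw [gaussianVector, charFun_pi]
  simp_rw [charFun_stdComplexGaussian]
  rw [← Complex.exp_sum]
  congr 1
  push_cast
  rw [Finset.sum_neg_distrib, Finset.sum_div]

/-- A map whose real adjoint is isometric transports Gaussian vectors to Gaussian vectors. -/
theorem map_gaussianVector {ι κ : Type*} [Fintype ι] [Fintype κ]
    {f : (ι → ℂ) → (κ → ℂ)} {g : (κ → ℂ) → (ι → ℂ)} (hf : Measurable f)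
    (hadj : ∀ x t, ∑ j, inner ℝ (f x j) (t j) = ∑ i, inner ℝ (x i) (g t i))
    (hg : ∀ t, ∑ i, ‖g t i‖ ^ 2 = ∑ j, ‖t j‖ ^ 2) :
    (gaussianVector ι).map f = gaussianVector κ := by
  have : IsProbabilityMeasure ((gaussianVector ι).map f) :=
    Measure.isProbabilityMeasure_map hf.aemeasurable
  refine (MeasurableEquiv.toLp 2 (κ → ℂ)).map_measurableEquiv_injective
      <| Measure.ext_of_charFun <| funext fun t ↦ ?_
  obtain ⟨t, rfl⟩ : ∃ s, WithLp.toLp 2 s = t := ⟨t.ofLp, rfl⟩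
  rw [MeasurableEquiv.coe_toLp, charFun_gaussianVector, ← hg, ← charFun_gaussianVector]
  rw [Measure.map_map (by fun_prop) hf, charFun_apply, charFun_apply,
    integral_map (by fun_prop) (by fun_prop), integral_map (by fun_prop) (by fun_prop)]
  refine integral_congr_ae (ae_of_all _ fun x => ?_)
  have := hadj x t
  simp only [PiLp.inner_apply, Function.comp_apply] at this ⊢
  rw [this]

/-! ### Concentration of the squared norm. -/

/-- No bound on `s` is needed: for `s ≥ 1` the integral diverges and both sides are 0 by convention.
-/
theorem integral_exp_sq_gaussianReal (s : ℝ) :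
    ∫ x, Real.exp (s * x ^ 2) ∂(gaussianReal 0 (1 / 2)) = (√(1 - s))⁻¹ := by
  rw [integral_gaussianReal_eq_integral_smul (by norm_num)]
  have h : ∀ x : ℝ, gaussianPDFReal 0 (1 / 2) x • Real.exp (s * x ^ 2) =
      (√Real.pi)⁻¹ * Real.exp (-(1 - s) * x ^ 2) := by
    intro x
    rw [gaussianPDFReal, smul_eq_mul, mul_assoc, ← Real.exp_add]
    congr 2
    · congr 1; push_cast; ring
    · push_cast; ring
  simp_rw [h]
  rw [integral_const_mul, integral_gaussian, Real.sqrt_div Real.pi_pos.le]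
  have := Real.sqrt_pos.2 Real.pi_pos
  field_simp

theorem integral_exp_sq_stdComplexGaussian {s : ℝ} (hs : s < 1) :
    ∫ z, Real.exp (s * ‖z‖ ^ 2) ∂stdComplexGaussian = (1 - s)⁻¹ := by
  rw [integral_stdComplexGaussian]
  have h : ∀ p : ℝ × ℝ, Real.exp (s * ‖(⟨p.1, p.2⟩ : ℂ)‖ ^ 2) =
      Real.exp (s * p.1 ^ 2) * Real.exp (s * p.2 ^ 2) := by
    intro p
    rw [← Real.exp_add, Complex.sq_norm, Complex.normSq_apply]
    ring_nf
  simp_rw [h]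
  rw [integral_prod_mul (fun x : ℝ => Real.exp (s * x ^ 2)) (fun x : ℝ => Real.exp (s * x ^ 2)),
    integral_exp_sq_gaussianReal s, ← mul_inv, Real.mul_self_sqrt (by linarith)]

/-- The squared Euclidean norm of a complex vector. -/
noncomputable def sqNorm {ι : Type*} [Fintype ι] (u : ι → ℂ) : ℝ := ∑ i, ‖u i‖ ^ 2

theorem sqNorm_nonneg {ι : Type*} [Fintype ι] (u : ι → ℂ) : 0 ≤ sqNorm u :=
  Finset.sum_nonneg fun _ _ => by positivity

theorem measurable_sqNorm {ι : Type*} [Fintype ι] : Measurable (sqNorm : (ι → ℂ) → ℝ) := by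
  unfold sqNorm; fun_prop

theorem mgf_sqNorm {ι : Type*} [Fintype ι] {s : ℝ} (hs : s < 1) :
    mgf sqNorm (gaussianVector ι) s = (1 - s)⁻¹ ^ Fintype.card ι := by
  rw [mgf, ← integral_exp_sq_stdComplexGaussian hs, gaussianVector, ← integral_fintype_prod_eq_pow]
  simp_rw [sqNorm, Finset.mul_sum, Real.exp_sum]

/-- Since eˣ ≥ 1 + x, it suffices that (1 − s)(1 + s + 2s²) = 1 + s²(1 − 2s) ≥ 1. -/
theorem inv_one_sub_le_exp {s : ℝ} (hs : s ≤ 1 / 2) : (1 - s)⁻¹ ≤ Real.exp (s + 2 * s ^ 2) := by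
  have h1 := Real.add_one_le_exp (s + 2 * s ^ 2)
  have h2 : (1 - s) * Real.exp (s + 2 * s ^ 2) ≥ 1 := by
    nlinarith [mul_nonneg (sq_nonneg s) (by linarith : 0 ≤ 1 - 2 * s)]
  rw [inv_le_iff_one_le_mul₀' (by linarith)]
  exact h2

/-- A non-integrable function would have integral 0 by convention, but the computed value is
positive. -/
theorem integrable_exp_sqNorm {ι : Type*} [Fintype ι] {s : ℝ} (hs : s < 1) :
    Integrable (fun u => Real.exp (s * sqNorm u)) (gaussianVector ι) := by
  by_contra h
  have h1 := mgf_sqNorm (ι := ι) hs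
  rw [mgf, integral_undef h] at h1
  have : 0 < (1 - s)⁻¹ ^ Fintype.card ι := pow_pos (inv_pos.2 (by linarith)) _
  linarith

/-- Chernoff bound for the squared norm of a Gaussian vector. -/
theorem measureReal_sqNorm_deviation_le {ι : Type*} [Fintype ι] {η : ℝ} (hη : 0 < η) (hη1 : η ≤ 1) :
    (gaussianVector ι).real {u | η * Fintype.card ι < |sqNorm u - Fintype.card ι|} ≤
      2 * Real.exp (-(η ^ 2 / 8)) ^ Fintype.card ι := by
  set d := Fintype.card ι
  have hsub : {u : ι → ℂ | η * d < |sqNorm u - d|} ⊆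
      {u | (1 + η) * d ≤ sqNorm u} ∪ {u | sqNorm u ≤ (1 - η) * d} := by
    intro u hu
    rcases lt_abs.1 hu.out with h | h
    · left; rw [Set.mem_ofPred_eq]; linarith
    · right; rw [Set.mem_ofPred_eq]; linarith
  have key : ∀ s : ℝ, s ≤ 1 / 2 → ∀ a : ℝ, -s * a + (s + 2 * s ^ 2) ≤ -(η ^ 2 / 8) →
      Real.exp (-s * (a * d)) * mgf sqNorm (gaussianVector ι) s ≤
        Real.exp (-(η ^ 2 / 8)) ^ d := by
    intro s hs a ha
    rw [mgf_sqNorm (by linarith)]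
    calc Real.exp (-s * (a * d)) * (1 - s)⁻¹ ^ d
        ≤ Real.exp (-s * (a * d)) * Real.exp (s + 2 * s ^ 2) ^ d := by
          gcongr
          · exact inv_nonneg.2 (by linarith)
          · exact inv_one_sub_le_exp hs
      _ = Real.exp (-s * a + (s + 2 * s ^ 2)) ^ d := by
          rw [← Real.exp_nat_mul, ← Real.exp_nat_mul, ← Real.exp_add]
          ring_nf
      _ ≤ _ := by gcongr
  -- Both tails have exponent −|s|η + 2s² per coordinate, minimal at |s| = η/4 with value −η²/8.
  have h1 := measure_ge_le_exp_mul_mgf (μ := gaussianVector ι) (X := sqNorm) (t := η / 4)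
    ((1 + η) * d) (by linarith) (integrable_exp_sqNorm (by linarith))
  have h2 := measure_le_le_exp_mul_mgf (μ := gaussianVector ι) (X := sqNorm) (t := -(η / 4))
    ((1 - η) * d) (by linarith) (integrable_exp_sqNorm (by linarith))
  have h3 := key (η / 4) (by linarith) (1 + η) (by nlinarith)
  have h4 := key (-(η / 4)) (by linarith) (1 - η) (by nlinarith)
  calc _ ≤ (gaussianVector ι).real ({u | (1 + η) * d ≤ sqNorm u} ∪ {u | sqNorm u ≤ (1 - η) * d}) :=
        measureReal_mono hsub
    _ ≤ _ := measureReal_union_le _ _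
    _ ≤ _ := by linarith

/-! ### Algebra of the resolvent form. -/

/-- The quadratic form `uᴴ (Hᴴ H + δ I)⁻¹ u` of the resolvent. -/
noncomputable def resolventForm {m k : Type*} [Fintype m] [Fintype k] [DecidableEq k]
    (δ : ℝ) (H : Matrix m k ℂ) (u : k → ℂ) : ℝ :=
  (star u ⬝ᵥ ((Hᴴ * H + (δ : ℂ) • (1 : Matrix k k ℂ))⁻¹ *ᵥ u)).re

section Algebra

variable {m k : Type*} [Fintype m] [Fintype k] [DecidableEq k]

theorem re_dotProduct_diagonal_conj (V : Matrix k k ℂ) (f : k → ℝ) (u : k → ℂ) :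
    (star u ⬝ᵥ ((V * diagonal (fun i => (f i : ℂ)) * Vᴴ) *ᵥ u)).re =
      ∑ i, ‖(Vᴴ *ᵥ u) i‖ ^ 2 * f i := by
  have h : star u ⬝ᵥ ((V * diagonal (fun i => (f i : ℂ)) * Vᴴ) *ᵥ u) =
      star (Vᴴ *ᵥ u) ⬝ᵥ (diagonal (fun i => (f i : ℂ)) *ᵥ (Vᴴ *ᵥ u)) := by
    rw [star_mulVec, conjTranspose_conjTranspose, ← dotProduct_mulVec, mulVec_mulVec, mulVec_mulVec]
  rw [h, dotProduct, Complex.re_sum]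
  refine Finset.sum_congr rfl fun i _ => ?_
  rw [mulVec_diagonal, Complex.sq_norm, Complex.normSq_apply]
  simp
  ring

/-- Joint diagonalization of the resolvent form and of the transmit power in the multiplier. -/
theorem exists_spectral_weights (H : Matrix m k ℂ) (u : k → ℂ) :
    ∃ l w : k → ℝ, (∀ i, 0 ≤ l i) ∧ (∀ i, 0 ≤ w i) ∧ ∑ i, w i = sqNorm u ∧
      (∀ δ, 0 < δ → resolventForm δ H u = ∑ i, w i * (l i + δ)⁻¹) ∧
      (∀ γ δ, 0 < δ → transmitPower γ δ H u = γ * ∑ i, w i * (l i * ((l i + δ)⁻¹) ^ 2)) := by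
  have hps : (Hᴴ * H).PosSemidef := posSemidef_conjTranspose_mul_self H
  have hG := hps.isHermitian
  obtain ⟨V, hV⟩ : ∃ V : Matrix k k ℂ, V = hG.eigenvectorUnitary.1 := ⟨_, rfl⟩
  have hVV : V * Vᴴ = 1 := hV ▸ Unitary.mul_star_self_of_mem hG.eigenvectorUnitary.2
  have hVV' : Vᴴ * V = 1 := hV ▸ Unitary.star_mul_self_of_mem hG.eigenvectorUnitary.2
  set l := hG.eigenvalues with hl
  have hl0 : ∀ i, 0 ≤ l i := hps.eigenvalues_nonneg
  have hspec : Hᴴ * H = V * diagonal (fun i => (l i : ℂ)) * Vᴴ := by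
    conv_lhs => rw [hG.spectral_theorem, Unitary.conjStarAlgAut_apply]
    rw [hV]
    rfl
  have hmul : ∀ f g : k → ℝ, (V * diagonal (fun i => (f i : ℂ)) * Vᴴ) *
      (V * diagonal (fun i => (g i : ℂ)) * Vᴴ) =
      V * diagonal (fun i => ((f i * g i : ℝ) : ℂ)) * Vᴴ := by
    intro f g
    calc _ = V * diagonal (fun i => (f i : ℂ)) * (Vᴴ * V) * diagonal (fun i => (g i : ℂ)) * Vᴴ := by
          simp only [Matrix.mul_assoc]
      _ = V * (diagonal (fun i => (f i : ℂ)) * diagonal (fun i => (g i : ℂ))) * Vᴴ := by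
          rw [hVV', Matrix.mul_one, Matrix.mul_assoc V]
      _ = _ := by rw [diagonal_mul_diagonal]; simp
  have hinv : ∀ δ : ℝ, 0 < δ → (Hᴴ * H + (δ : ℂ) • (1 : Matrix k k ℂ))⁻¹ =
      V * diagonal (fun i => (((l i + δ)⁻¹ : ℝ) : ℂ)) * Vᴴ := by
    intro δ hδ
    have hB : Hᴴ * H + (δ : ℂ) • (1 : Matrix k k ℂ) =
        V * diagonal (fun i => ((l i + δ : ℝ) : ℂ)) * Vᴴ := by
      have : diagonal (fun i => ((l i + δ : ℝ) : ℂ)) =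
          diagonal (fun i => (l i : ℂ)) + (δ : ℂ) • (1 : Matrix k k ℂ) := by
        rw [smul_one_eq_diagonal, diagonal_add]; simp
      rw [this, Matrix.mul_add, Matrix.add_mul, ← hspec, Matrix.mul_smul, Matrix.mul_one,
        Matrix.smul_mul, hVV]
    refine inv_eq_left_inv ?_
    rw [hB, hmul]
    have : (fun i => (((l i + δ)⁻¹ * (l i + δ) : ℝ) : ℂ)) = fun _ => 1 := by
      funext i
      rw [inv_mul_cancel₀ (by linarith [hl0 i])]; simp
    rw [this, diagonal_one, Matrix.mul_one, hVV]
  -- The weights are the squared moduli of the coordinates of `u` in an eigenbasis of HᴴH; they do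
  -- not depend on δ.
  refine ⟨l, fun i => ‖(Vᴴ *ᵥ u) i‖ ^ 2, hl0, fun i => by positivity, ?_, ?_, ?_⟩
  · have h1 := re_dotProduct_diagonal_conj V (fun _ => 1) u
    have h2 := re_dotProduct_diagonal_conj (1 : Matrix k k ℂ) (fun _ => 1) u
    simp only [Complex.ofReal_one, diagonal_one, hVV, mul_one,
      conjTranspose_one, one_mulVec] at h1 h2
    rw [← h1, h2, sqNorm]
  · intro δ hδ
    rw [resolventForm, hinv δ hδ, re_dotProduct_diagonal_conj]
  · intro γ δ hδ
    rw [transmitPower, hinv δ hδ, hspec, hmul, hmul, re_dotProduct_diagonal_conj]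
    congr 1
    refine Finset.sum_congr rfl fun i _ => ?_
    ring

theorem resolventForm_nonneg {δ : ℝ} (hδ : 0 < δ) (H : Matrix m k ℂ) (u : k → ℂ) :
    0 ≤ resolventForm δ H u := by
  obtain ⟨l, w, hl, hw, -, h, -⟩ := exists_spectral_weights H u
  rw [h δ hδ]
  exact Finset.sum_nonneg fun i _ => mul_nonneg (hw i) (inv_nonneg.2 (by linarith [hl i]))

theorem resolventForm_le {δ : ℝ} (hδ : 0 < δ) (H : Matrix m k ℂ) (u : k → ℂ) :
    resolventForm δ H u ≤ sqNorm u / δ := by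
  obtain ⟨l, w, hl, hw, hs, h, -⟩ := exists_spectral_weights H u
  rw [h δ hδ, ← hs, Finset.sum_div]
  refine Finset.sum_le_sum fun i _ => ?_
  rw [div_eq_mul_inv]
  have := hl i
  have := hw i
  gcongr
  linarith

/-- The transmit power as a difference quotient of the resolvent form, up to a controlled error. -/
theorem abs_transmitPower_sub_le {γ δ ε : ℝ} (hγ : 0 < γ) (hδ : 0 < δ) (hε : 0 < ε)
    (H : Matrix m k ℂ) (u : k → ℂ) :
    |transmitPower γ δ H u - γ * (resolventForm δ H u -
      δ * ((resolventForm δ H u - resolventForm (δ + ε) H u) / ε))| ≤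
      γ * (ε / δ ^ 2 * sqNorm u) := by
  obtain ⟨l, w, hl, hw, hs, h, h'⟩ := exists_spectral_weights H u
  rw [h δ hδ, h (δ + ε) (by linarith), h' γ δ hδ, ← mul_sub, abs_mul, abs_of_pos hγ]
  refine mul_le_mul_of_nonneg_left ?_ hγ.le
  rw [← Finset.sum_sub_distrib, Finset.sum_div, Finset.mul_sum, ← Finset.sum_sub_distrib,
    ← Finset.sum_sub_distrib, ← hs, Finset.mul_sum]
  refine (Finset.abs_sum_le_sum_abs _ _).trans (Finset.sum_le_sum fun i _ => ?_)
  have hli := hl i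
  -- Per eigenvalue, l/(l + δ)² = 1/(l + δ) − δ/(l + δ)², and the difference quotient has 1/((l +
  -- δ)(l + δ + ε)) in place of 1/(l + δ)².
  have e : w i * (l i * (l i + δ)⁻¹ ^ 2) - (w i * (l i + δ)⁻¹ -
      δ * ((w i * (l i + δ)⁻¹ - w i * (l i + (δ + ε))⁻¹) / ε)) =
      -(w i * (δ * ε * ((l i + δ)⁻¹ ^ 2 * (l i + (δ + ε))⁻¹))) := by
    have h1 : l i + δ ≠ 0 := by positivity
    have h2 : l i + (δ + ε) ≠ 0 := by positivity
    field_simp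
    ring
  have hwi := hw i
  rw [e, abs_neg, abs_of_nonneg (by positivity), mul_comm (ε / δ ^ 2)]
  refine mul_le_mul_of_nonneg_left ?_ hwi
  calc δ * ε * ((l i + δ)⁻¹ ^ 2 * (l i + (δ + ε))⁻¹)
      ≤ δ * ε * (δ⁻¹ ^ 2 * δ⁻¹) := by gcongr <;> linarith
    _ = ε / δ ^ 2 := by field_simp

/-- Conjugating the regularized Gram matrix by U only replaces H by HU. This moves a rotation of the
vector onto the Gaussian matrix, whose law does not see it. -/
theorem resolventForm_unitary {δ : ℝ} (H : Matrix m k ℂ) {U : Matrix k k ℂ} (hU : U * Uᴴ = 1)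
    (v : k → ℂ) : resolventForm δ H (U *ᵥ v) = resolventForm δ (H * U) v := by
  have hU' : Uᴴ * U = 1 := mul_eq_one_comm.1 hU
  have hUi : U⁻¹ = Uᴴ := inv_eq_right_inv hU
  have hUi' : Uᴴ⁻¹ = U := inv_eq_right_inv hU'
  have e : (H * U)ᴴ * (H * U) + (δ : ℂ) • (1 : Matrix k k ℂ) =
      Uᴴ * (Hᴴ * H + (δ : ℂ) • (1 : Matrix k k ℂ)) * U := by
    rw [Matrix.mul_add, Matrix.add_mul, Matrix.mul_smul, Matrix.smul_mul, Matrix.mul_one, hU',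
      conjTranspose_mul]
    simp only [Matrix.mul_assoc]
  rw [resolventForm, resolventForm, e, Matrix.mul_inv_rev, Matrix.mul_inv_rev, hUi, hUi', star_mulVec,
    ← dotProduct_mulVec, mulVec_mulVec, mulVec_mulVec, Matrix.mul_assoc]

/-- The inverse is Hermitian, so the form is its own conjugate. -/
theorem ofReal_resolventForm {δ : ℝ} (H : Matrix m k ℂ) (u : k → ℂ) :
    ((resolventForm δ H u : ℝ) : ℂ) =
      star u ⬝ᵥ ((Hᴴ * H + (δ : ℂ) • (1 : Matrix k k ℂ))⁻¹ *ᵥ u) := by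
  set B := Hᴴ * H + (δ : ℂ) • (1 : Matrix k k ℂ) with hB
  have hBH : (B⁻¹)ᴴ = B⁻¹ := by
    rw [conjTranspose_nonsing_inv]; simp [hB]
  refine Complex.conj_eq_iff_re.1 ?_
  change star _ = _
  conv_lhs => rw [← star_dotProduct_star, star_star, star_mulVec, hBH]
  exact (dotProduct_mulVec _ _ _).symm

end Algebra

/-! ### Schur complement and rotation to the first basis vector. -/

/-- The adjoint of a matrix with its first column removed. -/
def tailAdjoint {m : Type*} {k : ℕ} (H : Matrix m (Fin (k + 1)) ℂ) : Matrix (Fin k) m ℂ :=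
  Matrix.of fun j i => star (H i j.succ)

/-- The Schur complement formula for the corner entry of the resolvent. -/
theorem resolventForm_single {m : Type*} [Fintype m] [DecidableEq m] {k : ℕ} {δ : ℝ} (hδ : 0 < δ)
    (H : Matrix m (Fin (k + 1)) ℂ) (a : ℂ) :
    resolventForm δ H (Pi.single 0 a) =
      ‖a‖ ^ 2 / (δ * (1 + resolventForm δ (tailAdjoint H) (fun i => H i 0))) := by
  set T := tailAdjoint H with hT
  set h : m → ℂ := fun i => H i 0 with hh
  set C := Tᴴ * T + (δ : ℂ) • (1 : Matrix m m ℂ) with hC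
  set s := resolventForm δ T h with hs
  have hs0 : 0 ≤ s := resolventForm_nonneg hδ T h
  set q : m → ℂ := C⁻¹ *ᵥ h with hq
  have hCq : C *ᵥ q = h := by
    rw [hq, mulVec_mulVec, mul_nonsing_inv _ ((isUnit_iff_isUnit_det _).1 (isUnit_regularized hδ T)),
      one_mulVec]
  have hsq : star h ⬝ᵥ q = (s : ℂ) := (ofReal_resolventForm T h).symm
  set x₁ : ℂ := a / (δ * (1 + s)) with hx₁
  have hden : (δ : ℂ) * (1 + s) ≠ 0 := by
    have : δ * (1 + s) ≠ 0 := by positivity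
    exact_mod_cast this
  -- Block elimination for (HᴴH + δ)x = a e₁: the lower rows force the tail −x₁Tq, which collapses
  -- Hx to x₁δq, and the first row becomes δ(1 + s)x₁ = a.
  set x : Fin (k + 1) → ℂ := Fin.cons x₁ (-x₁ • (T *ᵥ q)) with hx
  have hTT : Tᴴ *ᵥ (T *ᵥ q) = h - (δ : ℂ) • q := by
    rw [← hCq, hC, add_mulVec, mulVec_mulVec, smul_mulVec, one_mulVec]; simp
  have hHx : H *ᵥ x = (x₁ * δ) • q := by
    have h1 : H *ᵥ x = x₁ • h + Tᴴ *ᵥ (-x₁ • (T *ᵥ q)) := by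
      ext i
      simp only [mulVec, dotProduct, Fin.sum_univ_succ, hx, Fin.cons_zero, Fin.cons_succ,
        Pi.add_apply, Pi.smul_apply, smul_eq_mul, hh, hT, tailAdjoint, conjTranspose_apply,
        Matrix.of_apply, star_star]
      ring
    rw [h1, mulVec_smul, hTT, smul_sub, smul_smul, neg_smul, neg_mul, neg_smul]
    abel
  have hBx : (Hᴴ * H + (δ : ℂ) • (1 : Matrix (Fin (k + 1)) (Fin (k + 1)) ℂ)) *ᵥ x =
      Pi.single 0 a := by
    rw [add_mulVec, ← mulVec_mulVec, hHx, mulVec_smul, smul_mulVec, one_mulVec]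
    ext j
    refine Fin.cases ?_ (fun j => ?_) j
    · have : (Hᴴ *ᵥ q) 0 = star h ⬝ᵥ q := rfl
      simp only [Pi.add_apply, Pi.smul_apply, smul_eq_mul, this, hsq, hx, Fin.cons_zero,
        Pi.single_eq_same]
      rw [hx₁]
      field_simp
      ring
    · have : (Hᴴ *ᵥ q) j.succ = (T *ᵥ q) j := rfl
      simp only [Pi.add_apply, Pi.smul_apply, smul_eq_mul, this, hx, Fin.cons_succ,
        Pi.single_eq_of_ne (Fin.succ_ne_zero j)]
      ring
  have hsol : (Hᴴ * H + (δ : ℂ) • (1 : Matrix (Fin (k + 1)) (Fin (k + 1)) ℂ))⁻¹ *ᵥ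
      Pi.single 0 a = x := by
    rw [← hBx, mulVec_mulVec,
      nonsing_inv_mul _ ((isUnit_iff_isUnit_det _).1 (isUnit_regularized hδ H)), one_mulVec]
  rw [resolventForm, hsol]
  have h0 : star (Pi.single 0 a : Fin (k + 1) → ℂ) ⬝ᵥ x = star a * x₁ := by
    rw [← Pi.single_star, single_dotProduct, hx, Fin.cons_zero]
  rw [h0, hx₁, mul_div_assoc']
  have h1 : star a * a = ((‖a‖ ^ 2 : ℝ) : ℂ) := by
    rw [Complex.star_def, Complex.conj_mul']; simp
  rw [h1, ← Complex.ofReal_one, ← Complex.ofReal_add, ← Complex.ofReal_mul, ← Complex.ofReal_div,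
    Complex.ofReal_re]

theorem sqNorm_eq_norm_sq {ι : Type*} [Fintype ι] (u : ι → ℂ) :
    sqNorm u = ‖(WithLp.toLp 2 u : EuclideanSpace ℂ ι)‖ ^ 2 := by
  rw [EuclideanSpace.norm_sq_eq]; rfl

/-- Every vector is a unitary image of a multiple of the first basis vector. -/
theorem exists_unitary_mulVec_single {k : ℕ} (u : Fin (k + 1) → ℂ) :
    ∃ U : Matrix (Fin (k + 1)) (Fin (k + 1)) ℂ, U * Uᴴ = 1 ∧
      u = U *ᵥ Pi.single 0 ((√(sqNorm u) : ℝ) : ℂ) := by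
  by_cases hu : u = 0
  · subst hu
    exact ⟨1, by simp, by simp [sqNorm]⟩
  set v : EuclideanSpace ℂ (Fin (k + 1)) := WithLp.toLp 2 u with hv
  have hv0 : v ≠ 0 := by simpa [hv] using hu
  have hn : √(sqNorm u) = ‖v‖ := by rw [sqNorm_eq_norm_sq, Real.sqrt_sq (norm_nonneg _)]
  have hvn : (‖v‖ : ℂ) ≠ 0 := by simpa using hv0
  -- The constant family is prescribed on the index set {0} only, so orthonormality just says that
  -- v/‖v‖ is a unit vector.
  obtain ⟨b, hb⟩ := Orthonormal.exists_orthonormalBasis_extension_of_card_eq (𝕜 := ℂ)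
    (E := EuclideanSpace ℂ (Fin (k + 1))) (ι := Fin (k + 1)) (by simp)
    (v := fun _ => ((‖v‖ : ℂ)⁻¹) • v) (s := {0}) (by
      constructor
      · intro i
        simp [norm_smul, hv0]
      · intro i j hij
        exact absurd (Subsingleton.elim i j) hij)
  have hb0 := hb 0 rfl
  refine ⟨(EuclideanSpace.basisFun (Fin (k + 1)) ℂ).toBasis.toMatrix b,
    OrthonormalBasis.toMatrix_orthonormalBasis_self_mul_conjTranspose _ _, ?_⟩
  ext i
  rw [hn, mulVec_single]
  simp [Module.Basis.toMatrix_apply, hb0]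
  field_simp
  rfl

/-! ### Measurability and the recursion in law. -/

theorem continuous_resolventForm {X m k : Type*} [TopologicalSpace X] [Fintype m] [Fintype k]
    [DecidableEq k] {δ : ℝ} (hδ : 0 < δ) {H : X → Matrix m k ℂ} {u : X → k → ℂ}
    (hH : Continuous H) (hu : Continuous u) :
    Continuous fun x => resolventForm δ (H x) (u x) := by
  have hB : Continuous fun x => (H x)ᴴ * H x + (δ : ℂ) • (1 : Matrix k k ℂ) := by fun_prop
  have hI : Continuous fun x => ((H x)ᴴ * H x + (δ : ℂ) • (1 : Matrix k k ℂ))⁻¹ := by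
    refine continuous_iff_continuousAt.2 fun x => ?_
    refine ContinuousAt.comp (continuousAt_matrix_inv _ ?_) hB.continuousAt
    obtain ⟨d, hd⟩ := (isUnit_iff_isUnit_det _).1 (isUnit_regularized hδ (H x))
    rw [← hd]
    exact NormedRing.inverse_continuousAt d
  unfold resolventForm
  fun_prop

theorem continuous_of_uncurry {m k : Type*} :
    Continuous fun z : m × k → ℂ => (Matrix.of fun i j => z (i, j) : Matrix m k ℂ) :=
  continuous_matrix fun i j => continuous_apply (i, j)

theorem measurable_resolventForm {m k : Type*} [Fintype m] [Fintype k]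
    [DecidableEq k] {δ : ℝ} (hδ : 0 < δ) :
    Measurable fun p : (m × k → ℂ) × (k → ℂ) =>
      resolventForm δ (Matrix.of fun i j => p.1 (i, j)) p.2 :=
  (continuous_resolventForm hδ (continuous_of_uncurry.comp continuous_fst) continuous_snd).measurable

/-- The law of the squared norm of a Gaussian vector of length `d`. -/
noncomputable def sqNormLaw (d : ℕ) : Measure ℝ := (gaussianVector (Fin d)).map sqNorm

/-- The law of the resolvent form for a Gaussian `m × k` matrix and an independent Gaussian
vector. -/
noncomputable def resolventLaw (m k : ℕ) (δ : ℝ) : Measure ℝ :=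
  ((gaussianVector (Fin m × Fin k)).prod (gaussianVector (Fin k))).map fun p =>
    resolventForm δ (Matrix.of fun i j => p.1 (i, j)) p.2

instance (d : ℕ) : IsProbabilityMeasure (sqNormLaw d) :=
  Measure.isProbabilityMeasure_map measurable_sqNorm.aemeasurable

theorem isProbabilityMeasure_resolventLaw (m k : ℕ) {δ : ℝ} (hδ : 0 < δ) :
    IsProbabilityMeasure (resolventLaw m k δ) :=
  Measure.isProbabilityMeasure_map (measurable_resolventForm hδ).aemeasurable

theorem map_gaussianVector_sum (ι κ : Type*) [Fintype ι] [Fintype κ] :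
    (gaussianVector (ι ⊕ κ)).map (fun z => (fun i => z (Sum.inl i), fun j => z (Sum.inr j))) =
      (gaussianVector ι).prod (gaussianVector κ) :=
  (measurePreserving_sumPiEquivProdPi (fun _ : ι ⊕ κ => stdComplexGaussian)).map_eq

/-- Right multiplication by a unitary matrix preserves the law of a Gaussian matrix. -/
theorem map_gaussianVector_mul_unitary {m k : Type*} [Fintype m] [Fintype k] [DecidableEq k]
    {U : Matrix k k ℂ} (hU : U * Uᴴ = 1) :
    (gaussianVector (m × k)).map (fun z p => ((Matrix.of fun i j => z (i, j)) * U) p.1 p.2) =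
      gaussianVector (m × k) := by
  have hU' : Uᴴ * U = 1 := mul_eq_one_comm.1 hU
  have hin : ∀ v w : k → ℂ, ∑ j, inner ℝ (v j) (w j) = (star v ⬝ᵥ w).re := by
    intro v w
    rw [dotProduct, Complex.re_sum]
    exact Finset.sum_congr rfl fun j _ => by
      rw [Complex.inner, mul_comm]; rfl
  refine map_gaussianVector
    (g := fun t p => ((Matrix.of fun i j => t (i, j)) * Uᴴ : Matrix m k ℂ) p.1 p.2) ?_ ?_ ?_
  · refine Continuous.measurable (continuous_pi fun p => ?_)
    exact (continuous_of_uncurry.matrix_mul continuous_const).matrix_elem p.1 p.2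
  · intro x t
    rw [Fintype.sum_prod_type, Fintype.sum_prod_type]
    refine Finset.sum_congr rfl fun i _ => ?_
    rw [hin (fun j => ((Matrix.of fun i j => x (i, j)) * U) i j) (fun j => t (i, j)),
      hin (fun j => x (i, j)) (fun j => ((Matrix.of fun i j => t (i, j)) * Uᴴ) i j)]
    congr 1
    simp only [dotProduct, Matrix.mul_apply, Pi.star_apply, star_sum, star_mul', Matrix.of_apply,
      conjTranspose_apply, Finset.sum_mul, Finset.mul_sum]
    rw [Finset.sum_comm]
    refine Finset.sum_congr rfl fun a _ => Finset.sum_congr rfl fun b _ => ?_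
    ring
  · intro t
    rw [Fintype.sum_prod_type, Fintype.sum_prod_type]
    refine Finset.sum_congr rfl fun i _ => ?_
    have hn : ∀ v : k → ℂ, ∑ j, ‖v j‖ ^ 2 = (star v ⬝ᵥ v).re := by
      intro v
      rw [← hin]
      exact Finset.sum_congr rfl fun j _ => (real_inner_self_eq_norm_sq _).symm
    rw [hn (fun j => ((Matrix.of fun i j => t (i, j)) * Uᴴ) i j), hn (fun j => t (i, j))]
    have : (fun j => ((Matrix.of fun i j => t (i, j)) * Uᴴ) i j) =
        (fun j => t (i, j)) ᵥ* Uᴴ := rfl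
    rw [this, star_vecMul, conjTranspose_conjTranspose, dotProduct_comm, ← dotProduct_mulVec,
      mulVec_mulVec, hU', one_mulVec, dotProduct_comm]

/-- The adjoint of the trailing columns and the first column of a Gaussian matrix are independent
and Gaussian. -/
theorem map_gaussianVector_tailAdjoint (m : Type*) [Fintype m] (k : ℕ) :
    (gaussianVector (m × Fin (k + 1))).map (fun z =>
      ((fun p : Fin k × m => star (z (p.2, p.1.succ))), fun i : m => z (i, 0))) =
      (gaussianVector (Fin k × m)).prod (gaussianVector m) := by
  have h : (gaussianVector (m × Fin (k + 1))).map (fun z =>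
      (Sum.elim (fun p : Fin k × m => star (z (p.2, p.1.succ))) fun i : m => z (i, 0))) =
      gaussianVector ((Fin k × m) ⊕ m) := by
    -- Entrywise conjugation is only ℝ-linear; this is why the transport criterion uses the real
    -- inner product.
    refine map_gaussianVector (g := fun t p =>
      (Fin.cases (t (Sum.inr p.1)) (fun j => star (t (Sum.inl (j, p.1)))) p.2 : ℂ)) ?_ ?_ ?_
    · refine measurable_pi_lambda _ fun s => ?_
      rcases s with s | s
      · simp only [Sum.elim_inl]; fun_prop
      · simp only [Sum.elim_inr]; fun_prop
    · intro x t
      rw [Fintype.sum_sum_type, Fintype.sum_prod_type, Fintype.sum_prod_type]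
      simp only [Fin.sum_univ_succ, Fin.cases_zero, Fin.cases_succ, Sum.elim_inl, Sum.elim_inr]
      rw [Finset.sum_add_distrib, add_comm, Finset.sum_comm]
      congr 1
      refine Finset.sum_congr rfl fun i _ => Finset.sum_congr rfl fun j _ => ?_
      simp [Complex.inner]
    · intro t
      rw [Fintype.sum_sum_type, Fintype.sum_prod_type, Fintype.sum_prod_type]
      simp only [Fin.sum_univ_succ, Fin.cases_zero, Fin.cases_succ, norm_star]
      rw [Finset.sum_add_distrib, add_comm, Finset.sum_comm]
  rw [← map_gaussianVector_sum, ← h, Measure.map_map (by fun_prop)]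
  · rfl
  · refine measurable_pi_lambda _ fun s => ?_
    rcases s with s | s
    · simp only [Sum.elim_inl]; fun_prop
    · simp only [Sum.elim_inr]; fun_prop

/-- The distributional recursion of the resolvent form. -/
theorem resolventLaw_succ (m k : ℕ) {δ : ℝ} (hδ : 0 < δ) :
    resolventLaw m (k + 1) δ =
      ((sqNormLaw (k + 1)).prod (resolventLaw k m δ)).map (fun p => p.1 / (δ * (1 + p.2))) := by
  have := isProbabilityMeasure_resolventLaw k m hδ
  have hΦ : Measurable fun p : ℝ × ℝ => p.1 / (δ * (1 + p.2)) := by fun_prop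
  ext S hS
  rw [Measure.map_apply hΦ hS, Measure.prod_apply (hΦ hS), sqNormLaw,
    lintegral_map (measurable_measure_prodMk_left (hΦ hS)) measurable_sqNorm, resolventLaw,
    Measure.map_apply (measurable_resolventForm hδ) hS,
    Measure.prod_apply_symm (measurable_resolventForm hδ hS)]
  -- Conditionally on `u` the rotation is a fixed matrix, absorbed by the law of H. The identity is
  -- needed for each `u` separately, so the rotation need not depend measurably on `u`.
  refine lintegral_congr fun u => ?_
  obtain ⟨U, hU, hu⟩ := exists_unitary_mulVec_single u
  have hmS : MeasurableSet ((fun y => sqNorm u / (δ * (1 + y))) ⁻¹' S) :=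
    (by fun_prop : Measurable fun y => sqNorm u / (δ * (1 + y))) hS
  have hmT : MeasurableSet {p : (Fin k × Fin m → ℂ) × (Fin m → ℂ) |
      sqNorm u / (δ * (1 + resolventForm δ (Matrix.of fun i j => p.1 (i, j)) p.2)) ∈ S} :=
    measurable_resolventForm hδ hmS
  have hR : resolventLaw k m δ (Prod.mk (sqNorm u) ⁻¹' ((fun p => p.1 / (δ * (1 + p.2))) ⁻¹' S)) =
      (gaussianVector (Fin m × Fin (k + 1))) {z | sqNorm u / (δ * (1 + resolventForm δ
        (tailAdjoint (Matrix.of fun i j => z (i, j))) (fun i => z (i, 0)))) ∈ S} := by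
    change resolventLaw k m δ ((fun y => sqNorm u / (δ * (1 + y))) ⁻¹' S) = _
    rw [resolventLaw, Measure.map_apply (measurable_resolventForm hδ) hmS,
      ← map_gaussianVector_tailAdjoint]
    rw [Measure.map_apply (by fun_prop) (measurable_resolventForm hδ hmS)]
    rfl
  rw [hR]
  conv_rhs => rw [← map_gaussianVector_mul_unitary hU]
  rw [Measure.map_apply]
  · congr 1
    ext z
    simp only [Set.mem_preimage, Set.mem_ofPred_eq]
    have h1 := resolventForm_single hδ ((Matrix.of fun i j => z (i, j)) * U)
      ((√(sqNorm u) : ℝ) : ℂ)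
    rw [← resolventForm_unitary _ hU, ← hu, Complex.norm_real, Real.norm_of_nonneg
      (Real.sqrt_nonneg _), Real.sq_sqrt (sqNorm_nonneg u)] at h1
    rw [h1]
    rfl
  · refine Continuous.measurable (continuous_pi fun p => ?_)
    exact (continuous_of_uncurry.matrix_mul continuous_const).matrix_elem p.1 p.2
  · have : Measurable fun z : Fin m × Fin (k + 1) → ℂ =>
      ((fun p : Fin k × Fin m => star (z (p.2, p.1.succ))), fun i : Fin m => z (i, 0)) := by
      fun_prop
    exact this hmT

/-! ### From independent entries to the product laws. -/

section Realization

variable {Ω : Type*} [MeasurableSpace Ω] {μ : Measure Ω} {m k : ℕ}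
  {H : Ω → Matrix (Fin m) (Fin k) ℂ} {u : Ω → Fin k → ℂ}

theorem hasLaw_gaussianVector_entries [IsProbabilityMeasure μ]
    (hH : ∀ i j, HasLaw (fun ω => H ω i j) stdComplexGaussian μ)
    (hu : ∀ j, HasLaw (fun ω => u ω j) stdComplexGaussian μ)
    (hindep : iIndepFun
      (Sum.elim (fun (p : Fin m × Fin k) ω => H ω p.1 p.2) (fun j ω => u ω j)) μ) :
    HasLaw (fun ω => ((fun p : Fin m × Fin k => H ω p.1 p.2), u ω))
      ((gaussianVector (Fin m × Fin k)).prod (gaussianVector (Fin k))) μ := by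
  have hl : ∀ s, HasLaw ((Sum.elim (fun (p : Fin m × Fin k) ω => H ω p.1 p.2)
      (fun j ω => u ω j)) s) stdComplexGaussian μ := by
    rintro (p | j)
    · exact hH p.1 p.2
    · exact hu j
  have h1 := (iIndepFun_iff_map_fun_eq_pi_map fun s => (hl s).aemeasurable).1 hindep
  simp_rw [fun s => (hl s).map_eq] at h1
  have hm := aemeasurable_pi_lambda _ fun s => (hl s).aemeasurable
  have hsplit : Measurable fun z : (Fin m × Fin k) ⊕ Fin k → ℂ =>
      ((fun i => z (Sum.inl i)), fun j => z (Sum.inr j)) := by fun_prop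
  refine ⟨hsplit.comp_aemeasurable hm, ?_⟩
  rw [← map_gaussianVector_sum, gaussianVector, ← h1,
    AEMeasurable.map_map_of_aemeasurable hsplit.aemeasurable hm]
  rfl

theorem hasLaw_resolventForm {δ : ℝ} (hδ : 0 < δ)
    (h : HasLaw (fun ω => ((fun p : Fin m × Fin k => H ω p.1 p.2), u ω))
      ((gaussianVector (Fin m × Fin k)).prod (gaussianVector (Fin k))) μ) :
    HasLaw (fun ω => resolventForm δ (H ω) (u ω)) (resolventLaw m k δ) μ := by
  have hF := measurable_resolventForm (m := Fin m) (k := Fin k) hδ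
  have e : (fun ω => resolventForm δ (H ω) (u ω)) =
      (fun p : (Fin m × Fin k → ℂ) × (Fin k → ℂ) =>
        resolventForm δ (Matrix.of fun i j => p.1 (i, j)) p.2) ∘
      (fun ω => ((fun p : Fin m × Fin k => H ω p.1 p.2), u ω)) := by
    funext ω
    rw [Function.comp_apply]
    congr 1
  rw [e]
  refine ⟨hF.comp_aemeasurable h.aemeasurable, ?_⟩
  rw [resolventLaw, ← h.map_eq, AEMeasurable.map_map_of_aemeasurable hF.aemeasurable h.aemeasurable]

theorem hasLaw_sqNorm
    (h : HasLaw (fun ω => ((fun p : Fin m × Fin k => H ω p.1 p.2), u ω))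
      ((gaussianVector (Fin m × Fin k)).prod (gaussianVector (Fin k))) μ) :
    HasLaw (fun ω => sqNorm (u ω)) (sqNormLaw k) μ where
  aemeasurable := (measurable_sqNorm.comp measurable_snd).comp_aemeasurable h.aemeasurable
  map_eq := by
    have : (gaussianVector (Fin k)) =
        ((gaussianVector (Fin m × Fin k)).prod (gaussianVector (Fin k))).map Prod.snd := by
      rw [Measure.map_snd_prod]; simp
    rw [sqNormLaw, this, ← h.map_eq, Measure.map_map measurable_sqNorm measurable_snd,
      AEMeasurable.map_map_of_aemeasurable (measurable_sqNorm.comp measurable_snd).aemeasurable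
        h.aemeasurable]
    rfl

end Realization

/-! ### The limit function: quadratic equation, fixed point, derivative. -/

section MarchenkoPastur

variable {c ρ : ℝ}

theorem mpTransform_eq (c ρ : ℝ) :
    mpTransform c ρ = 2 / (ρ + c - 1 + √((ρ + c - 1) ^ 2 + 4 * ρ)) := by
  rw [mpTransform, show (1 - c + ρ) ^ 2 + 4 * c * ρ = (ρ + c - 1) ^ 2 + 4 * ρ by ring,
    ← neg_div_neg_eq]
  ring_nf

theorem mpTransform_pos (hc : 1 ≤ c) (hρ : 0 < ρ) : 0 < mpTransform c ρ := by
  rw [mpTransform_eq]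
  have : 0 < ρ + c - 1 := by linarith
  positivity

theorem mpTransform_quadratic (hc : 1 ≤ c) (hρ : 0 < ρ) :
    ρ * mpTransform c ρ ^ 2 + (ρ + c - 1) * mpTransform c ρ = 1 := by
  rw [mpTransform_eq]
  have hb : 0 < ρ + c - 1 := by linarith
  set b := ρ + c - 1
  have hs := Real.sq_sqrt (by positivity : 0 ≤ b ^ 2 + 4 * ρ)
  have hs0 := Real.sqrt_nonneg (b ^ 2 + 4 * ρ)
  set s := √(b ^ 2 + 4 * ρ)
  have : b + s ≠ 0 := by positivity
  field_simp
  linarith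

/-- Dropping the nonnegative terms ρm² and (c − 1)m from the quadratic leaves ρm ≤ 1. -/
theorem mpTransform_le (hc : 1 ≤ c) (hρ : 0 < ρ) : mpTransform c ρ ≤ 1 / ρ := by
  have h := mpTransform_quadratic hc hρ
  have hp := mpTransform_pos hc hρ
  rw [le_div_iff₀ hρ]
  nlinarith [mul_nonneg hρ.le (sq_nonneg (mpTransform c ρ)),
    mul_nonneg (by linarith : 0 ≤ c - 1) hp.le]

theorem mpTransform_fixedPoint (hc : 1 ≤ c) (hρ : 0 < ρ) :
    mpTransform c ρ = (1 + mpTransform c ρ) / (ρ * (1 + mpTransform c ρ) + c) := by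
  have h := mpTransform_quadratic hc hρ
  have hp := mpTransform_pos hc hρ
  rw [eq_div_iff (by positivity)]
  linarith

/-- Implicit differentiation of the quadratic, which holds throughout a neighbourhood of ρ. -/
theorem deriv_mpTransform (hc : 1 ≤ c) (hρ : 0 < ρ) :
    deriv (mpTransform c) ρ = -((mpTransform c ρ ^ 2 + mpTransform c ρ) /
      (2 * ρ * mpTransform c ρ + (ρ + c - 1))) := by
  have hd := (differentiableAt_mpTransform (c := c) hρ).hasDerivAt
  set m := mpTransform c ρ with hm
  set m' := deriv (mpTransform c) ρ
  have hp : 0 < m := mpTransform_pos hc hρ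
  have h1 : HasDerivAt (fun r => r * mpTransform c r ^ 2 + (r + c - 1) * mpTransform c r)
      ((1 * m ^ 2 + ρ * (2 * m * m')) + (1 * m + (ρ + c - 1) * m')) ρ := by
    refine HasDerivAt.add (HasDerivAt.mul (hasDerivAt_id ρ) ?_) (HasDerivAt.mul ?_ hd)
    · simpa using hd.fun_pow 2
    · simpa using ((hasDerivAt_id ρ).add_const c).sub_const 1
  have h2 : HasDerivAt (fun r => r * mpTransform c r ^ 2 + (r + c - 1) * mpTransform c r) 0 ρ := by
    refine (hasDerivAt_const ρ (1 : ℝ)).congr_of_eventuallyEq ?_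
    filter_upwards [lt_mem_nhds hρ] with r hr
    exact mpTransform_quadratic hc hr
  have h3 := h1.unique h2
  have hb : 0 < ρ + c - 1 := by linarith
  rw [← neg_div, eq_div_iff (by positivity)]
  linarith

/-- The difference quotient approximates the derivative uniformly in the aspect ratio. -/
theorem abs_deriv_mpTransform_add_le {h : ℝ} (hc : 1 ≤ c) (hρ : 0 < ρ) (hh : 0 < h) :
    |deriv (mpTransform c) ρ + (mpTransform c ρ - mpTransform c (ρ + h)) / h| ≤
      ((2 / ρ + 1) / ρ + (1 / ρ ^ 2 + 1 / ρ) / ρ) * ((1 / ρ ^ 2 + 1 / ρ) / ρ) * h := by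
  have hρh : 0 < ρ + h := by linarith
  rw [deriv_mpTransform hc hρ]
  have ha := mpTransform_quadratic hc hρ
  have hb := mpTransform_quadratic hc hρh
  have ha0 := mpTransform_pos hc hρ
  have hb0 := mpTransform_pos hc hρh
  have ha1 := mpTransform_le hc hρ
  have hb1 := (mpTransform_le hc hρh).trans
    (one_div_le_one_div_of_le hρ (by linarith : ρ ≤ ρ + h))
  set a := mpTransform c ρ
  set b := mpTransform c (ρ + h)
  set β := ρ + c - 1 with hβ
  have hβρ : ρ ≤ β := by linarith
  set D := 2 * ρ * a + β with hD
  set E := ρ * (a + b) + β with hE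
  have hDρ : ρ ≤ D := by have := mul_pos hρ ha0; linarith
  have hEρ : ρ ≤ E := by have := mul_pos hρ (add_pos ha0 hb0); linarith
  have hD0 : 0 < D := by linarith
  have hE0 : 0 < E := by linarith
  -- Subtracting the quadratics at ρ and ρ + h.
  have hab : a - b = h * (b ^ 2 + b) / E := by
    rw [eq_div_iff hE0.ne', hE]
    have : (ρ + h) * b ^ 2 + (β + h) * b = 1 := by rw [← hb, hβ]; ring
    linarith
  have hb2 : b ^ 2 + b ≤ 1 / ρ ^ 2 + 1 / ρ := by
    have : b ^ 2 ≤ (1 / ρ) ^ 2 := by gcongr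
    rw [div_pow, one_pow] at this
    linarith
  have hab0 : 0 ≤ a - b := by rw [hab]; positivity
  have hab1 : a - b ≤ (1 / ρ ^ 2 + 1 / ρ) / ρ * h := by
    rw [hab]
    calc h * (b ^ 2 + b) / E ≤ h * (1 / ρ ^ 2 + 1 / ρ) / ρ := by gcongr
      _ = _ := by ring
  -- Both a² + a − (b² + b) and D − E are multiples of a − b, which is O(h); hence so is the whole
  -- error.
  have e : -((a ^ 2 + a) / D) + (a - b) / h =
      -((a - b) * ((a + b + 1) / D)) + (a - b) * ((b ^ 2 + b) * ρ / (D * E)) := by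
    have h1 : (a - b) / h = (b ^ 2 + b) / E := by rw [hab]; field_simp
    have h2 : D - E = ρ * (a - b) := by rw [hD, hE]; ring
    rw [h1, ← sub_eq_zero]
    have h3 : (a - b) * ((b ^ 2 + b) * ρ / (D * E)) = (b ^ 2 + b) * (D - E) / (D * E) := by
      rw [h2]; ring
    rw [h3]
    field_simp
    ring
  rw [e]
  have h4 : (a + b + 1) / D ≤ (2 / ρ + 1) / ρ := by
    gcongr
    have : 2 / ρ = 1 / ρ + 1 / ρ := by ring
    linarith
  have h5 : (b ^ 2 + b) * ρ / (D * E) ≤ (1 / ρ ^ 2 + 1 / ρ) / ρ := by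
    calc (b ^ 2 + b) * ρ / (D * E) ≤ (1 / ρ ^ 2 + 1 / ρ) * ρ / (ρ * ρ) := by gcongr
      _ = _ := by field_simp
  have h6 : 0 ≤ (a + b + 1) / D := by positivity
  have h7 : 0 ≤ (b ^ 2 + b) * ρ / (D * E) := by positivity
  calc |-((a - b) * ((a + b + 1) / D)) + (a - b) * ((b ^ 2 + b) * ρ / (D * E))|
      ≤ |-((a - b) * ((a + b + 1) / D))| + |(a - b) * ((b ^ 2 + b) * ρ / (D * E))| :=
        abs_add_le _ _
    _ = (a - b) * ((a + b + 1) / D + (b ^ 2 + b) * ρ / (D * E)) := by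
        rw [abs_neg, abs_of_nonneg (by positivity), abs_of_nonneg (by positivity)]; ring
    _ ≤ (1 / ρ ^ 2 + 1 / ρ) / ρ * h * ((2 / ρ + 1) / ρ + (1 / ρ ^ 2 + 1 / ρ) / ρ) := by gcongr
    _ = _ := by ring

end MarchenkoPastur

/-! ### Deterministic contraction estimates. -/

section Contraction

variable {ρ x c η s t N a b y z : ℝ}

/-- Replacing a/N by 1 costs at most η/ρ because 1/(ρ(1 + y)) ≤ 1/ρ. -/
theorem abs_div_sub_le_of_abs_sub_one_le (hρ : 0 < ρ) (hN : 0 < N) (ha : |a / N - 1| ≤ η)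
    (hy : 0 ≤ y) (hs : |1 / (ρ * (1 + y)) - x| ≤ s) :
    |a / (N * ρ * (1 + y)) - x| ≤ η / ρ + s := by
  have e : a / (N * ρ * (1 + y)) - x =
      (a / N - 1) * (1 / (ρ * (1 + y))) + (1 / (ρ * (1 + y)) - x) := by
    field_simp
    ring
  rw [e]
  refine (abs_add_le _ _).trans (add_le_add ?_ hs)
  rw [abs_mul, abs_of_nonneg (a := 1 / (ρ * (1 + y))) (by positivity), div_eq_mul_one_div η]
  have hη : 0 ≤ η := (abs_nonneg _).trans ha
  gcongr
  nlinarith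

/-- With B = b/N the expression is (1 + z)/(ρ(1 + z) + B). Moving B to c costs η/ρ². Moving z to x
multiplies the distance by c/((ρ(1 + z) + c)(ρ(1 + x) + c)); the second factor absorbs c and the
first is at least 1 + ρ because c ≥ 1. -/
theorem abs_inv_sub_le_of_fixedPoint (hρ : 0 < ρ) (hN : 0 < N) (hx : 0 ≤ x) (hc : 1 ≤ c)
    (hfix : x = (1 + x) / (ρ * (1 + x) + c)) (hb0 : 0 ≤ b) (hb : |b / N - c| ≤ η)
    (hz : 0 ≤ z) (ht : |z - x| ≤ t) :
    |1 / (ρ * (1 + b / (N * ρ * (1 + z)))) - x| ≤ η / ρ ^ 2 + t / (1 + ρ) := by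
  set B := b / N with hB
  have hB0 : 0 ≤ B := by positivity
  have e1 : 1 / (ρ * (1 + b / (N * ρ * (1 + z)))) = (1 + z) / (ρ * (1 + z) + B) := by
    rw [hB]; field_simp
  have e2 : (1 + z) / (ρ * (1 + z) + B) - x =
      -((B - c) * ((1 + z) / ((ρ * (1 + z) + B) * (ρ * (1 + z) + c)))) +
      (z - x) * (c / ((ρ * (1 + z) + c) * (ρ * (1 + x) + c))) := by
    have : (1 + z) / (ρ * (1 + z) + B) - x =
      (1 + z) / (ρ * (1 + z) + B) - (1 + x) / (ρ * (1 + x) + c) := by rw [← hfix]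
    rw [this]
    field_simp
    ring
  have hη : 0 ≤ η := (abs_nonneg _).trans hb
  have ht0 : 0 ≤ t := (abs_nonneg _).trans ht
  rw [e1, e2]
  refine (abs_add_le _ _).trans (add_le_add ?_ ?_)
  · rw [abs_neg, abs_mul, abs_of_nonneg (a := (1 + z) / _) (by positivity), div_eq_mul_one_div η]
    refine mul_le_mul hb ?_ (by positivity) hη
    rw [div_le_div_iff₀ (by positivity) (by positivity)]
    have h1 : ρ * (1 + z) ≤ ρ * (1 + z) + B := by linarith
    have h2 : ρ ≤ ρ * (1 + z) + c := by nlinarith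
    nlinarith [mul_le_mul h1 h2 hρ.le (by positivity)]
  · rw [abs_mul, abs_of_nonneg (a := c / _) (by positivity), div_eq_mul_one_div t]
    refine mul_le_mul ht ?_ (by positivity) ht0
    rw [div_le_div_iff₀ (by positivity) (by positivity)]
    have h1 : 1 + ρ ≤ ρ * (1 + z) + c := by nlinarith
    have h2 : c ≤ ρ * (1 + x) + c := by nlinarith
    nlinarith [mul_le_mul h1 h2 (by linarith) (by positivity)]

end Contraction

/-! ### Exceptional probabilities along the recursion. -/

theorem measureReal_map_prod_compl_le {χ ν : Measure ℝ} [IsProbabilityMeasure χ]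
    [IsProbabilityMeasure ν] {Φ : ℝ × ℝ → ℝ} (hΦ : Measurable Φ) {A B T : Set ℝ}
    (hT : MeasurableSet T) (h : ∀ a ∈ A, ∀ b ∈ B, Φ (a, b) ∈ T) :
    ((χ.prod ν).map Φ).real Tᶜ ≤ χ.real Aᶜ + ν.real Bᶜ := by
  rw [map_measureReal_apply hΦ hT.compl]
  have hsub : Φ ⁻¹' Tᶜ ⊆ (Aᶜ ×ˢ Set.univ) ∪ (Set.univ ×ˢ Bᶜ) := by
    rintro ⟨a, b⟩ hab
    by_cases ha : a ∈ A
    · right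
      refine ⟨trivial, fun hb => hab (h a ha b hb)⟩
    · left
      exact ⟨ha, trivial⟩
  calc _ ≤ (χ.prod ν).real ((Aᶜ ×ˢ Set.univ) ∪ (Set.univ ×ˢ Bᶜ)) := measureReal_mono hsub
    _ ≤ _ := measureReal_union_le _ _
    _ = _ := by rw [measureReal_prod_prod, measureReal_prod_prod]; simp

/-- The nonnegative numbers at distance at most `t` from `x`. -/
def nonnegBall (x t : ℝ) : Set ℝ := {z | 0 ≤ z ∧ |z - x| ≤ t}

theorem measurableSet_nonnegBall (x t : ℝ) : MeasurableSet (nonnegBall x t) :=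
  (measurableSet_le measurable_const measurable_id).inter
    (measurableSet_le (by fun_prop : Measurable fun z : ℝ => |z - x|) measurable_const)

/-- Two steps of the distributional recursion contract towards the fixed point. -/
theorem resolventLaw_succ_succ_compl_le (m k : ℕ) {ρ x c η t N : ℝ} (hρ : 0 < ρ) (hN : 0 < N)
    (hx : 0 ≤ x) (hc : 1 ≤ c) (hfix : x = (1 + x) / (ρ * (1 + x) + c)) :
    (resolventLaw (m + 1) (k + 1) (N * ρ)).real
        (nonnegBall x (η / ρ + (η / ρ ^ 2 + t / (1 + ρ))))ᶜ ≤
      (sqNormLaw (k + 1)).real {a | 0 ≤ a ∧ |a / N - 1| ≤ η}ᶜ +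
      ((sqNormLaw (m + 1)).real {b | 0 ≤ b ∧ |b / N - c| ≤ η}ᶜ +
        (resolventLaw m k (N * ρ)).real (nonnegBall x t)ᶜ) := by
  have hδ : 0 < N * ρ := by positivity
  have := isProbabilityMeasure_resolventLaw k (m + 1) hδ
  have := isProbabilityMeasure_resolventLaw m k hδ
  have hY : MeasurableSet {y : ℝ | 0 ≤ y ∧
      |1 / (ρ * (1 + y)) - x| ≤ η / ρ ^ 2 + t / (1 + ρ)} :=
    (measurableSet_le measurable_const measurable_id).inter
      (measurableSet_le (by fun_prop : Measurable fun y : ℝ => |1 / (ρ * (1 + y)) - x|)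
        measurable_const)
  rw [resolventLaw_succ _ _ hδ]
  refine (measureReal_map_prod_compl_le (A := {a | 0 ≤ a ∧ |a / N - 1| ≤ η}) (B := {y : ℝ | 0 ≤ y ∧
      |1 / (ρ * (1 + y)) - x| ≤ η / ρ ^ 2 + t / (1 + ρ)}) (by fun_prop)
    (measurableSet_nonnegBall _ _) ?_).trans (add_le_add le_rfl ?_)
  · rintro a ⟨ha0, ha⟩ y ⟨hy0, hy⟩
    exact ⟨by dsimp only; positivity, abs_div_sub_le_of_abs_sub_one_le hρ hN ha hy0 hy⟩
  · rw [resolventLaw_succ _ _ hδ]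
    refine measureReal_map_prod_compl_le (by fun_prop) hY ?_
    rintro b ⟨hb0, hb⟩ z ⟨hz0, hz⟩
    exact ⟨by dsimp only; positivity, abs_inv_sub_le_of_fixedPoint hρ hN hx hc hfix hb0 hb hz0 hz⟩

/-- The Chernoff bound is geometric in d ≥ K − j. The offset `j` is there because the recursion
peels off a bounded number of dimensions while the normalization stays K. -/
theorem summable_measureReal_sqNormLaw {d N : ℕ → ℕ} {j : ℕ} {C η : ℝ} (hη : 0 < η)
    (hd : ∀ᶠ K in atTop, K ≤ d K + j) (hN : ∀ᶠ K in atTop, N K ≤ d K + j)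
    (hdN : ∀ᶠ K in atTop, d K ≤ N K) (hC : ∀ᶠ K : ℕ in atTop, (N K : ℝ) ≤ C * K) :
    Summable fun K : ℕ =>
      (sqNormLaw (d K)).real {a | 0 ≤ a ∧ |a / K - (N K : ℝ) / K| ≤ η}ᶜ := by
  -- The Chernoff bound needs θ ≤ 1. The fluctuation θd ≤ θCK uses half of ηK; the other half
  -- absorbs the offset N − d ≤ j for large K.
  set θ := min 1 (η / (2 * (|C| + 1))) with hθ
  have hθ0 : 0 < θ := by positivity
  have hθC : θ * C ≤ η / 2 := by
    calc θ * C ≤ η / (2 * (|C| + 1)) * (|C| + 1) :=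
          (mul_le_mul_of_nonneg_left (by linarith [le_abs_self C]) hθ0.le).trans
            (mul_le_mul_of_nonneg_right (min_le_right _ _) (by positivity))
      _ = η / 2 := by field_simp
  set r := Real.exp (-(θ ^ 2 / 8)) with hr
  have hr0 : 0 < r := Real.exp_pos _
  have hr1 : r < 1 := by
    rw [hr, ← Real.exp_zero, Real.exp_lt_exp, neg_lt_zero]; positivity
  refine Summable.of_norm_bounded_eventually_nat (g := fun K => 2 / r ^ j * r ^ K)
    ((summable_geometric_of_lt_one hr0.le hr1).mul_left _) ?_
  have hlarge : ∀ᶠ K : ℕ in atTop, 2 * j / η ≤ K :=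
    tendsto_natCast_atTop_atTop.eventually_ge_atTop _
  filter_upwards [hd, hN, hdN, hC, hlarge, eventually_gt_atTop 0] with K hd hN hdN hC hlarge hK
  have hK0 : (0 : ℝ) < K := by exact_mod_cast hK
  have hNd : (N K : ℝ) ≤ d K + j := by exact_mod_cast hN
  have hdN' : (d K : ℝ) ≤ N K := by exact_mod_cast hdN
  rw [div_le_iff₀ hη] at hlarge
  have hms : MeasurableSet {a : ℝ | 0 ≤ a ∧ |a / K - (N K : ℝ) / K| ≤ η} :=
    (measurableSet_le measurable_const measurable_id).inter
      (measurableSet_le (by fun_prop : Measurable fun a : ℝ => |a / K - (N K : ℝ) / K|)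
        measurable_const)
  rw [Real.norm_of_nonneg measureReal_nonneg, sqNormLaw,
    map_measureReal_apply measurable_sqNorm hms.compl]
  have hsub : sqNorm ⁻¹' {a : ℝ | 0 ≤ a ∧ |a / K - (N K : ℝ) / K| ≤ η}ᶜ ⊆
      {u : Fin (d K) → ℂ | θ * Fintype.card (Fin (d K)) <
        |sqNorm u - Fintype.card (Fin (d K))|} := by
    intro u hu
    by_contra hcon
    refine hu ⟨sqNorm_nonneg u, ?_⟩
    rw [Set.mem_ofPred_eq, not_lt, Fintype.card_fin] at hcon
    rw [← sub_div, abs_div, abs_of_pos hK0, div_le_iff₀ hK0]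
    have h1 : θ * d K ≤ θ * C * K := by
      rw [mul_assoc]; gcongr; linarith
    have h2 : θ * C * K ≤ η / 2 * K := by gcongr
    rw [abs_le] at hcon ⊢
    constructor <;> linarith [hcon.1, hcon.2]
  calc _ ≤ _ := measureReal_mono hsub
    _ ≤ 2 * r ^ Fintype.card (Fin (d K)) :=
        measureReal_sqNorm_deviation_le hθ0 (min_le_left _ _)
    _ ≤ 2 / r ^ j * r ^ K := by
        rw [Fintype.card_fin, div_mul_eq_mul_div, le_div_iff₀ (by positivity), mul_assoc, ← pow_add]
        gcongr 2 * ?_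
        exact pow_le_pow_of_le_one hr0.le hr1.le hd

/-! ### Iteration and Borel–Cantelli. -/

section Concentration

variable {M : ℕ → ℕ} {C ρ : ℝ}

theorem one_le_ratio {m K : ℕ} (h : K < m) (hK : 0 < K) : (1 : ℝ) ≤ (m : ℝ) / K := by
  rw [one_le_div (by exact_mod_cast hK)]
  exact_mod_cast h.le

/-- After `n` double steps of the recursion the deviation is of order `L + (1 + ρ)⁻ⁿ`. -/
theorem summable_resolventLaw_iterate (hKM : ∀ K, K < M K)
    (hC : ∀ᶠ K : ℕ in atTop, (M K : ℝ) ≤ C * K) (hρ : 0 < ρ) {L : ℝ} (hL : 0 < L) (n j : ℕ) :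
    Summable fun K : ℕ => (resolventLaw (M K - j) (K - j) (K * ρ)).real
      (nonnegBall (mpTransform (M K / K) ρ) (L + 3 / ρ * (1 / (1 + ρ)) ^ n))ᶜ := by
  -- Each double step passes from offset j to j + 1 with the multiplier Kρ unchanged, so every
  -- offset is needed at once.
  induction n generalizing j with
  | zero =>
    refine Summable.of_norm_bounded_eventually_nat
      -- Off this event ‖u‖² ≤ 2K, so the form is at most 2/ρ; with m ≤ 1/ρ this gives the starting
      -- radius 3/ρ.
      (summable_measureReal_sqNormLaw (d := fun K => K - j) (N := fun K => K) (j := j) (C := 1)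
        one_pos (by filter_upwards with K using by omega) (by filter_upwards with K using by omega)
        (by filter_upwards with K using by omega) (by filter_upwards with K using by simp)) ?_
    filter_upwards [eventually_gt_atTop 0] with K hK
    have hK0 : (0 : ℝ) < K := by exact_mod_cast hK
    have hδ : 0 < K * ρ := by positivity
    have hms : MeasurableSet {a : ℝ | 0 ≤ a ∧ |a / K - (K : ℝ) / K| ≤ 1} :=
      (measurableSet_le measurable_const measurable_id).inter
        (measurableSet_le (by fun_prop : Measurable fun a : ℝ => |a / K - (K : ℝ) / K|)
          measurable_const)
    have hlaw : sqNormLaw (K - j) = ((gaussianVector (Fin (M K - j) × Fin (K - j))).prod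
        (gaussianVector (Fin (K - j)))).map (sqNorm ∘ Prod.snd) := by
      rw [← Measure.map_map measurable_sqNorm measurable_snd, Measure.map_snd_prod, sqNormLaw]
      simp
    have hc := one_le_ratio (hKM K) hK
    rw [Real.norm_of_nonneg measureReal_nonneg, hlaw, resolventLaw,
      map_measureReal_apply (measurable_resolventForm hδ) (measurableSet_nonnegBall _ _).compl,
      map_measureReal_apply (measurable_sqNorm.comp measurable_snd) hms.compl]
    refine measureReal_mono fun p hp hcon => hp ?_
    have h1 := resolventForm_nonneg hδ
      (Matrix.of fun i j => p.1 (i, j) : Matrix (Fin (M K - j)) (Fin (K - j)) ℂ) p.2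
    refine ⟨h1, ?_⟩
    have h2 := resolventForm_le hδ
      (Matrix.of fun i j => p.1 (i, j) : Matrix (Fin (M K - j)) (Fin (K - j)) ℂ) p.2
    have h3 : sqNorm p.2 / (K * ρ) ≤ 2 / ρ := by
      have h4 := (abs_le.1 hcon.2).2
      rw [div_self hK0.ne', Function.comp_apply] at h4
      rw [← div_div]
      gcongr
      linarith
    have h5 := mpTransform_pos hc hρ
    have h6 := mpTransform_le hc hρ
    have h7 : 0 < 1 / ρ := by positivity
    have h8 : 2 / ρ = 2 * (1 / ρ) := by ring
    have h9 : 3 / ρ = 3 * (1 / ρ) := by ring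
    rw [pow_zero, mul_one, abs_le]
    constructor <;> linarith
  | succ n ih =>
    -- Solves η/ρ + η/ρ² + L/(1 + ρ) = L, so that L is reproduced by the step and only the geometric
    -- term shrinks.
    set η := L * ρ ^ 3 / (1 + ρ) ^ 2 with hη
    have hη0 : 0 < η := by positivity
    have hstep : L + 3 / ρ * (1 / (1 + ρ)) ^ (n + 1) =
        η / ρ + (η / ρ ^ 2 + (L + 3 / ρ * (1 / (1 + ρ)) ^ n) / (1 + ρ)) := by
      rw [hη, pow_succ]
      field_simp
      ring
    have hA := summable_measureReal_sqNormLaw (d := fun K => K - j) (N := fun K => K) (j := j)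
      (C := 1) hη0 (by filter_upwards with K using by omega)
      (by filter_upwards with K using by omega)
      (by filter_upwards with K using by omega) (by filter_upwards with K using by simp)
    have hB := summable_measureReal_sqNormLaw (d := fun K => M K - j) (N := M) (j := j) hη0
      (by filter_upwards with K using by have := hKM K; omega)
      (by filter_upwards with K using by omega)
      (by filter_upwards with K using by omega) hC
    refine Summable.of_norm_bounded_eventually_nat (hA.add (hB.add (ih (j + 1)))) ?_
    filter_upwards [eventually_gt_atTop j] with K hK
    have hK' : 0 < K := by omega
    have hK0 : (0 : ℝ) < K := by exact_mod_cast hK'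
    have hc := one_le_ratio (hKM K) hK'
    have hMj : M K - j = (M K - (j + 1)) + 1 := by have := hKM K; omega
    have hKj : K - j = (K - (j + 1)) + 1 := by omega
    rw [Real.norm_of_nonneg measureReal_nonneg, hstep, hMj, hKj, div_self hK0.ne']
    exact resolventLaw_succ_succ_compl_le _ _ hρ hK0 (mpTransform_pos hc hρ).le hc
      (mpTransform_fixedPoint hc hρ)

/-- The number of double steps is chosen from ε and ρ alone, so it stays fixed as K grows. -/
theorem summable_resolventLaw (hKM : ∀ K, K < M K)
    (hC : ∀ᶠ K : ℕ in atTop, (M K : ℝ) ≤ C * K) (hρ : 0 < ρ) {ε : ℝ} (hε : 0 < ε) :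
    Summable fun K : ℕ => (resolventLaw (M K) K (K * ρ)).real
      (nonnegBall (mpTransform (M K / K) ρ) ε)ᶜ := by
  have hlim : Tendsto (fun n : ℕ => ε / 2 + 3 / ρ * (1 / (1 + ρ)) ^ n) atTop (𝓝 (ε / 2)) := by
    have := tendsto_pow_atTop_nhds_zero_of_lt_one (r := 1 / (1 + ρ)) (by positivity)
      ((div_lt_one (by positivity)).2 (by linarith))
    simpa using (this.const_mul (3 / ρ)).const_add (ε / 2)
  obtain ⟨n, hn⟩ := (hlim.eventually (gt_mem_nhds (half_lt_self hε))).exists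
  refine Summable.of_norm_bounded_eventually_nat
    (summable_resolventLaw_iterate hKM hC hρ (half_pos hε) n 0) ?_
  filter_upwards [eventually_gt_atTop 0] with K hK
  have hK0 : (0 : ℝ) < K := by exact_mod_cast hK
  have := isProbabilityMeasure_resolventLaw (M K) K (δ := K * ρ) (by positivity)
  rw [Real.norm_of_nonneg measureReal_nonneg]
  exact measureReal_mono (Set.compl_subset_compl.2 fun z hz => ⟨hz.1, hz.2.trans hn.le⟩)

variable {Ω : Type*} [MeasurableSpace Ω] {μ : Measure Ω} [IsProbabilityMeasure μ]

/-- Borel–Cantelli for laws with summable exceptional probabilities. -/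
theorem ae_eventually_mem_of_summable {X : ℕ → Ω → ℝ} {ν : ℕ → Measure ℝ} {S : ℕ → Set ℝ}
    (hX : ∀ᶠ K in atTop, HasLaw (X K) (ν K) μ) (hS : ∀ K, MeasurableSet (S K))
    (hsum : Summable fun K => (ν K).real (S K)ᶜ) :
    ∀ᵐ ω ∂μ, ∀ᶠ K in atTop, X K ω ∈ S K := by
  have h1 : Summable fun K => μ.real {ω | X K ω ∉ S K} := by
    refine Summable.of_norm_bounded_eventually_nat hsum ?_
    filter_upwards [hX] with K hX
    rw [Real.norm_of_nonneg measureReal_nonneg, measureReal_def, measureReal_def,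
      hX.measure_eq (p := fun x => x ∉ S K) (hS K).compl]
    rfl
  have h2 : ∑' K, μ {ω | X K ω ∉ S K} ≠ ⊤ := by
    have h3 : ∀ K, μ {ω | X K ω ∉ S K} = ENNReal.ofReal (μ.real {ω | X K ω ∉ S K}) :=
      fun K => (ofReal_measureReal).symm
    simp_rw [h3]
    exact h1.tsum_ofReal_ne_top
  filter_upwards [ae_eventually_notMem h2] with ω hω
  filter_upwards [hω] with K hK
  by_contra h
  exact hK h

variable {H : ∀ K : ℕ, Ω → Matrix (Fin (M K)) (Fin K) ℂ} {u : ∀ K : ℕ, Ω → Fin K → ℂ}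

/-- Almost sure convergence of the resolvent form to the Marchenko–Pastur transform. -/
theorem ae_tendsto_resolventForm (hKM : ∀ K, K < M K)
    (hC : ∀ᶠ K : ℕ in atTop, (M K : ℝ) ≤ C * K)
    (hlaw : ∀ K, HasLaw (fun ω => ((fun p : Fin (M K) × Fin K => H K ω p.1 p.2), u K ω))
      ((gaussianVector (Fin (M K) × Fin K)).prod (gaussianVector (Fin K))) μ) (hρ : 0 < ρ) :
    ∀ᵐ ω ∂μ, Tendsto (fun K : ℕ => resolventForm (K * ρ) (H K ω) (u K ω) -
      mpTransform (M K / K) ρ) atTop (𝓝 0) := by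
  have h : ∀ n : ℕ, ∀ᵐ ω ∂μ, ∀ᶠ K : ℕ in atTop, resolventForm (K * ρ) (H K ω) (u K ω) ∈
      nonnegBall (mpTransform (M K / K) ρ) (1 / ((n : ℝ) + 1)) := by
    intro n
    refine ae_eventually_mem_of_summable (ν := fun K => resolventLaw (M K) K (K * ρ)) ?_
      (fun K => measurableSet_nonnegBall _ _)
      (summable_resolventLaw hKM hC hρ (by positivity))
    -- At K = 0 the multiplier vanishes, so the law is only claimed for K > 0.
    filter_upwards [eventually_gt_atTop 0] with K hK
    have hK0 : (0 : ℝ) < K := by exact_mod_cast hK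
    exact hasLaw_resolventForm (by positivity) (hlaw K)
  filter_upwards [ae_all_iff.2 h] with ω hω
  rw [Metric.tendsto_atTop']
  intro ε hε
  obtain ⟨n, hn⟩ := exists_nat_one_div_lt hε
  obtain ⟨K₀, hK₀⟩ := eventually_atTop.1 (hω n)
  refine ⟨K₀, fun K hK => ?_⟩
  rw [Real.dist_eq, sub_zero]
  exact (hK₀ K hK.le).2.trans_lt hn

/-- Controls the factor ‖u‖² in the error of `abs_transmitPower_sub_le`. -/
theorem ae_eventually_sqNorm_le
    (hlaw : ∀ K, HasLaw (fun ω => ((fun p : Fin (M K) × Fin K => H K ω p.1 p.2), u K ω))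
      ((gaussianVector (Fin (M K) × Fin K)).prod (gaussianVector (Fin K))) μ) :
    ∀ᵐ ω ∂μ, ∀ᶠ K : ℕ in atTop, sqNorm (u K ω) ≤ 2 * K := by
  have h : ∀ᵐ ω ∂μ, ∀ᶠ K : ℕ in atTop,
      sqNorm (u K ω) ∈ {a : ℝ | 0 ≤ a ∧ |a / K - (K : ℝ) / K| ≤ 1} := by
    refine ae_eventually_mem_of_summable (ν := sqNormLaw)
      (Eventually.of_forall fun K => hasLaw_sqNorm (hlaw K)) (fun K => ?_)
      (summable_measureReal_sqNormLaw (d := fun K => K) (N := fun K => K) (j := 0) (C := 1)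
        one_pos (by simp) (by simp) (by simp) (by simp))
    exact (measurableSet_le measurable_const measurable_id).inter
      (measurableSet_le (by fun_prop : Measurable fun a : ℝ => |a / K - (K : ℝ) / K|)
        measurable_const)
  filter_upwards [h] with ω hω
  filter_upwards [hω, eventually_gt_atTop 0] with K hK hK'
  have hK0 : (0 : ℝ) < K := by exact_mod_cast hK'
  have := (abs_le.1 hK.2).2
  rw [div_self hK0.ne', sub_le_iff_le_add, div_le_iff₀ hK0] at this
  linarith

end Concentration

/-! ### From the resolvent form to the transmit power. -/

/-- Convergence of the transmit power along a realization, from convergence of the resolvent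
forms at nearby multipliers. -/
theorem tendsto_transmitPower {M : ℕ → ℕ} (hKM : ∀ K, K < M K)
    {H : ∀ K : ℕ, Matrix (Fin (M K)) (Fin K) ℂ} {u : ∀ K : ℕ, Fin K → ℂ} {γ ρ : ℝ}
    (hγ : 0 < γ) (hρ : 0 < ρ) (hu : ∀ᶠ K : ℕ in atTop, sqNorm (u K) ≤ 2 * K)
    (hlim₀ : Tendsto (fun K : ℕ => resolventForm (K * ρ) (H K) (u K) -
      mpTransform (M K / K) ρ) atTop (𝓝 0))
    (hlim : ∀ n : ℕ, Tendsto (fun K : ℕ => resolventForm (K * (ρ + 1 / ((n : ℝ) + 1))) (H K) (u K) -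
      mpTransform (M K / K) (ρ + 1 / ((n : ℝ) + 1))) atTop (𝓝 0)) :
    Tendsto (fun K : ℕ => transmitPower γ (K * ρ) (H K) (u K) -
      γ * (mpTransform (M K / K) ρ + ρ * deriv (mpTransform (M K / K)) ρ)) atTop (𝓝 0) := by
  -- B collects the coefficients of h in the two difference-quotient errors; the extra 1 in B + 1
  -- pays for the term that vanishes as K → ∞.
  set B := γ * (2 / ρ ^ 2) +
    γ * ρ * (((2 / ρ + 1) / ρ + (1 / ρ ^ 2 + 1 / ρ) / ρ) * ((1 / ρ ^ 2 + 1 / ρ) / ρ)) with hB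
  have hB0 : 0 < B := by positivity
  have key : ∀ n : ℕ, ∀ᶠ K : ℕ in atTop, |transmitPower γ (K * ρ) (H K) (u K) -
      γ * (mpTransform (M K / K) ρ + ρ * deriv (mpTransform (M K / K)) ρ)| <
      (B + 1) * (1 / ((n : ℝ) + 1)) := by
    intro n
    set h : ℝ := 1 / ((n : ℝ) + 1) with hh
    have hh0 : 0 < h := by positivity
    have herr : Tendsto (fun K : ℕ => γ * ((resolventForm (K * ρ) (H K) (u K) -
        mpTransform (M K / K) ρ) - ρ / h * ((resolventForm (K * ρ) (H K) (u K) -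
        mpTransform (M K / K) ρ) - (resolventForm (K * (ρ + h)) (H K) (u K) -
        mpTransform (M K / K) (ρ + h))))) atTop (𝓝 0) := by
      have hn := hlim n
      rw [← hh] at hn
      simpa using (hlim₀.sub ((hlim₀.sub hn).const_mul (ρ / h))).const_mul γ
    filter_upwards [hu, eventually_gt_atTop 0, (herr.abs).eventually
      (gt_mem_nhds (by simpa using hh0))] with K hu hK herr
    have hK0 : (0 : ℝ) < K := by exact_mod_cast hK
    -- The step scales with K like the multiplier, which makes the error 2γh/ρ² free of K.
    have h1 := abs_transmitPower_sub_le (δ := K * ρ) (ε := K * h) hγ (by positivity)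
      (by positivity) (H K) (u K)
    have h2 := abs_deriv_mpTransform_add_le (one_le_ratio (hKM K) hK) hρ hh0
    have h3 : γ * (K * h / (K * ρ) ^ 2 * sqNorm (u K)) ≤ γ * (2 / ρ ^ 2) * h := by
      calc γ * (K * h / (K * ρ) ^ 2 * sqNorm (u K))
          ≤ γ * (K * h / (K * ρ) ^ 2 * (2 * K)) := by gcongr
        _ = _ := by field_simp
    rw [← mul_add] at h1
    set P := transmitPower γ (K * ρ) (H K) (u K)
    set g := resolventForm (K * ρ) (H K) (u K)
    set g' := resolventForm (K * (ρ + h)) (H K) (u K)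
    set m := mpTransform (M K / K) ρ
    set m' := mpTransform (M K / K) (ρ + h)
    set D := deriv (mpTransform (M K / K)) ρ
    have e : P - γ * (m + ρ * D) =
        (P - γ * (g - K * ρ * ((g - g') / (K * h)))) +
        γ * ((g - m) - ρ / h * ((g - m) - (g' - m'))) + -(γ * ρ * (D + (m - m') / h)) := by
      field_simp
      ring
    rw [e]
    have h4 : |-(γ * ρ * (D + (m - m') / h))| ≤ γ * ρ *
        (((2 / ρ + 1) / ρ + (1 / ρ ^ 2 + 1 / ρ) / ρ) * ((1 / ρ ^ 2 + 1 / ρ) / ρ) * h) := by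
      rw [abs_neg, abs_mul, abs_of_pos (by positivity : 0 < γ * ρ)]
      gcongr
    refine (abs_add_three _ _ _).trans_lt ?_
    have h5 : (B + 1) * h = γ * (2 / ρ ^ 2) * h + h + γ * ρ *
        (((2 / ρ + 1) / ρ + (1 / ρ ^ 2 + 1 / ρ) / ρ) * ((1 / ρ ^ 2 + 1 / ρ) / ρ) * h) := by
      rw [hB]; ring
    rw [h5]
    linarith
  rw [Metric.tendsto_atTop']
  intro ε hε
  obtain ⟨n, hn⟩ := exists_nat_one_div_lt (div_pos hε (by linarith : 0 < B + 1))
  obtain ⟨K₀, hK₀⟩ := eventually_atTop.1 (key n)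
  refine ⟨K₀, fun K hK => ?_⟩
  rw [Real.dist_eq, sub_zero]
  refine (hK₀ K hK.le).trans ?_
  rwa [lt_div_iff₀' (by linarith)] at hn

theorem proposition4
    {Ω : Type*} [MeasurableSpace Ω] (μ : Measure Ω) [IsProbabilityMeasure μ]
    -- the number of antennas `M K` as a function of the number of users `K`
    (M : ℕ → ℕ) (hKM : ∀ K, K < M K)
    (hpace : (fun K => (M K : ℝ)) =Θ[atTop] (fun K => (K : ℝ)))
    -- the channel matrix and the data vector, with jointly i.i.d. `CN(0, 1)` entries for each `K`
    (H : ∀ K : ℕ, Ω → Matrix (Fin (M K)) (Fin K) ℂ)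
    (u : ∀ K : ℕ, Ω → (Fin K → ℂ))
    (hH : ∀ K i k, HasLaw (fun ω => H K ω i k) stdComplexGaussian μ)
    (hu : ∀ K k, HasLaw (fun ω => u K ω k) stdComplexGaussian μ)
    (hindep : ∀ K, iIndepFun
      (Sum.elim (fun (p : Fin (M K) × Fin K) ω => H K ω p.1 p.2) (fun k ω => u K ω k)) μ)
    (γ ρ : ℝ) (hγ : 0 < γ) (hρ : 0 < ρ) :
    ∀ᵐ ω ∂μ, Tendsto
      (fun K : ℕ => transmitPower γ (K * ρ) (H K ω) (u K ω) -
        γ * (mpTransform (M K / K) ρ + ρ * deriv (mpTransform (M K / K)) ρ))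
      atTop (𝓝 0) := by
  have hC : ∃ C : ℝ, ∀ᶠ K : ℕ in atTop, (M K : ℝ) ≤ C * K := by
    obtain ⟨C, hC⟩ := hpace.1.bound
    refine ⟨C, hC.mono fun K hK => ?_⟩
    simpa using hK
  obtain ⟨C, hC⟩ := hC
  have hlaw := fun K => hasLaw_gaussianVector_entries (hH K) (hu K) (hindep K)
  -- The steps 1/(n + 1) form a countable family, so one null set serves them all.
  filter_upwards [ae_eventually_sqNorm_le hlaw, ae_tendsto_resolventForm hKM hC hlaw hρ,
    ae_all_iff.2 fun n : ℕ => ae_tendsto_resolventForm hKM hC hlaw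
      (by positivity : 0 < ρ + 1 / ((n : ℝ) + 1))] with ω h1 h2 h3
  exact tendsto_transmitPower hKM hγ hρ h1 h2 h3
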